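/- Let $d\ge 1$ and let $\mathbb{R}_d$ be the real Clifford algebra with imaginary units $e_1,\dots,e_d$, $e_ie_j+e_je_i=-2\delta_{ij}$, with basis $e_A=e_{i_1}\cdots e_{i_r}$ for $A=\{i_1<\dots<i_r\}\subseteq\{1,\dots,d\}$. Identify $s=(s_0,\dots,s_d)\in\mathbb{R}^{d+1}$ with the paravector $s_0+\sum_{j=1}^d s_je_j\in\mathbb{R}_d$, and put $\overline{s}=s_0-\sum_{j=1}^d s_je_j$ and $|s|^2=\sum_{j=0}^d s_j^2$. Let $V$ be a real Banach space and $V_d=V\otimes\mathbb{R}_d$ with the norm $\|\sum_A v_A\otimes e_A\|^2=\sum_A\|v_A\|^2$; let $\mathcal{B}(V_d)$ be the bounded operators on $V_d$ with the operator norm. An element $a\in\mathbb{R}_d$ acts on $V_d$ by left multiplication, $a(\sum_A v_A\otimes e_A)=\sum_A v_A\otimes (ae_A)$, and for $S\in\mathcal{B}(V_d)$ the products $Sa$ and $aS$ are compositions with this action. Let $\mathcal{B}^{0,1}(V_d)$ be the set of bounded paravector operators $T=T_0+\sum_{j=1}^d e_jT_j$, where $T_0,\dots,T_d$ are bounded linear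 operators on $V$, acting coordinatewise on $V_d$ and not assumed to commute. Write $Q_s(T)=T^2-2s_0T+|s|^2\mathcal{I}$ and let $\sigma_S(T)=\{s\in\mathbb{R}^{d+1}: Q_s(T)\text{ is not invertible in }\mathcal{B}(V_d)\}$. For polynomials in $T$ with coefficients in $\mathbb{R}_d$, let $(\sum_k T^ka_k)\star_\ell(\sum_k T^kb_k)=\sum_k T^k\big(\sum_{i=0}^k a_ib_{k-i}\big)$ and $(\sum_k a_kT^k)\star_r(\sum_k b_kT^k)=\sum_k \big(\sum_{i=0}^k a_ib_{k-i}\big)T^k$ (products computed from the given coefficients), with powers $(\cdot)^{\star_\ell m}$ and $(\cdot)^{\star_r m}$. For $s\notin\sigma_S(T)$ and integers $m,n\ge 0$ define $$S_L^{-m}(s,T)\star_\ell S_L^{-n}(\overline{s},T):=Q_s(T)^{-(m+n)}\big[(\overline{s}\,\mathcal{I}-T)^{\star_\ell m}\star_\ell(s\,\mathcal{I}-T)^{\star_\ell n}\big],$$ $$S_R^{-m}(s,T)\star_r S_R^{-n}(\overline{s},T):=\big[(\overline{s}\,\mathcal{I}-T)^{\star_r m}\star_r(s\,\mathcal{I}-T)^{\star_r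 n}\big]Q_s(T)^{-(m+n)}.$$ **Proposition.** Let $T\in\mathcal{B}^{0,1}(V_d)$, let $\varepsilon>0$, and let $C\subset\mathbb{R}^{d+1}$ satisfy $\mathrm{dist}(C,\sigma_S(T))>\varepsilon$, where $\mathrm{dist}(C,\sigma_S(T))=\inf\{|s-p|:s\in C,\ p\in\sigma_S(T)\}$ (equal to $+\infty$ if one of the sets is empty). Then there is a constant $K_T>0$ such that $$\big\|S_L^{-m}(s,T)\star_\ell S_L^{-n}(\overline{s},T)\big\|\le\frac{K_T}{\varepsilon^{m+n}}\quad\text{and}\quad\big\|S_R^{-m}(s,T)\star_r S_R^{-n}(\overline{s},T)\big\|\le\frac{K_T}{\varepsilon^{m+n}}$$ for all $s\in C$ and all integers $m,n\ge 0$. -/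

import Mathlib

open scoped symmDiff

noncomputable section

namespace SFunctionalCalculus

/-! ### The real Clifford algebra and paravectors -/

/-- The quadratic form `x ↦ -(x₁² + ⋯ + xₙ²)` on `ℝⁿ`. -/
def negSumSq (n : ℕ) : QuadraticForm ℝ (Fin n → ℝ) :=
  QuadraticMap.weightedSumSquares ℝ (fun _ : Fin n => (-1 : ℝ))

/-- The real Clifford algebra `ℝₙ` over `n` imaginary units, `e_i e_j + e_j e_i = -2 δ_ij`. -/
abbrev RClifford (n : ℕ) : Type := CliffordAlgebra (negSumSq n)

/-- The imaginary unit `e_j`. -/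
def unit {n : ℕ} (j : Fin n) : RClifford n :=
  CliffordAlgebra.ι (negSumSq n) (Pi.single j 1)

/-- The element `e_A = e_{i₁} ⋯ e_{iᵣ}` for `A = {i₁ < ⋯ < iᵣ}`, with `e_∅ = 1`. -/
def basisElt {n : ℕ} (A : Finset (Fin n)) : RClifford n :=
  ((A.sort (· ≤ ·)).map unit).prod

/-- Paravectors `(x₀, x₁, …, xₙ) ∈ ℝⁿ⁺¹`, with the Euclidean norm. -/
abbrev Paravector (n : ℕ) : Type := EuclideanSpace ℝ (Fin (n + 1))

/-- The paravector `x` as the element `x₀ + ∑ x_j e_j` of the Clifford algebra. -/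
def Paravector.toClifford {n : ℕ} (x : Paravector n) : RClifford n :=
  algebraMap ℝ (RClifford n) (x 0) + ∑ j : Fin n, x j.succ • unit j

/-- The conjugate `x₀ - ∑ x_j e_j` of a paravector. -/
def Paravector.conj {n : ℕ} (x : Paravector n) : Paravector n :=
  WithLp.toLp 2 (Fin.cons (x 0) (fun j : Fin n => -x j.succ))

/-! ### The Banach module `Vₙ = V ⊗ ℝₙ` -/

/-- `Vₙ = V ⊗ ℝₙ`: the element `∑_A v_A ⊗ e_A` is given by its coordinates `v_A`, indexed by the
subsets `A` of `{1, …, n}`, and `‖v‖² = ∑_A ‖v_A‖²`. -/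
def Vn (n : ℕ) (V : Type*) : Type _ := PiLp 2 (fun _ : Finset (Fin n) => V)

section Operators

variable {n : ℕ} {V : Type*} [NormedAddCommGroup V] [NormedSpace ℝ V]

instance : NormedAddCommGroup (Vn n V) :=
  inferInstanceAs (NormedAddCommGroup (PiLp 2 (fun _ : Finset (Fin n) => V)))

instance : NormedSpace ℝ (Vn n V) :=
  inferInstanceAs (NormedSpace ℝ (PiLp 2 (fun _ : Finset (Fin n) => V)))

instance [CompleteSpace V] : CompleteSpace (Vn n V) :=
  inferInstanceAs (CompleteSpace (PiLp 2 (fun _ : Finset (Fin n) => V)))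

/-- The coordinates `(v_A)_A` of an element `∑_A v_A ⊗ e_A` of `Vₙ`. -/
def coord (n : ℕ) (V : Type*) [NormedAddCommGroup V] [NormedSpace ℝ V] :
    Vn n V ≃L[ℝ] (Finset (Fin n) → V) :=
  PiLp.continuousLinearEquiv 2 ℝ (fun _ : Finset (Fin n) => V)

theorem norm_sq_eq (v : Vn n V) : ‖v‖ ^ 2 = ∑ A, ‖coord n V v A‖ ^ 2 :=
  PiLp.norm_sq_eq_of_L2 (fun _ : Finset (Fin n) => V) v

/-- The bounded operator on `Vₙ` with the given bounded coordinate functionals. -/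
def ofCoords (F : Finset (Fin n) → ((Finset (Fin n) → V) →L[ℝ] V)) : Vn n V →L[ℝ] Vn n V :=
  ((coord n V).symm : (Finset (Fin n) → V) →L[ℝ] Vn n V) ∘L
    (ContinuousLinearMap.pi F) ∘L (coord n V : Vn n V →L[ℝ] (Finset (Fin n) → V))

/-- An operator `S` on `V` acts on `Vₙ` by `∑_A v_A ⊗ e_A ↦ ∑_A S(v_A) ⊗ e_A`. -/
def coordwise (n : ℕ) (S : V →L[ℝ] V) : Vn n V →L[ℝ] Vn n V :=
  ofCoords (fun B => S ∘L ContinuousLinearMap.proj B)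

/-- The sign in `e_j e_A = ± e_{A ∆ {j}}`: moving `e_j` to its place costs one sign for every
`a ∈ A` with `a < j`, and `e_j² = -1` costs one more if `j ∈ A`. -/
def unitSign (j : Fin n) (A : Finset (Fin n)) : ℝ := (-1) ^ (A.filter (· ≤ j)).card

/-- Left multiplication by `e_j` on `Vₙ`: `∑_A v_A ⊗ e_A ↦ ∑_A v_A ⊗ (e_j e_A)`. -/
def unitMul (V : Type*) [NormedAddCommGroup V] [NormedSpace ℝ V] (j : Fin n) :
    Vn n V →L[ℝ] Vn n V :=
  ofCoords (fun B => unitSign j (B ∆ {j}) • ContinuousLinearMap.proj (B ∆ {j}))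

theorem coord_ext {v w : Vn n V} (h : ∀ B, coord n V v B = coord n V w B) : v = w :=
  (coord n V).injective (funext h)

@[simp] theorem coordwise_apply (S : V →L[ℝ] V) (v : Vn n V) (B : Finset (Fin n)) :
    coord n V (coordwise n S v) B = S (coord n V v B) := rfl

@[simp] theorem unitMul_apply (j : Fin n) (v : Vn n V) (B : Finset (Fin n)) :
    coord n V (unitMul V j v) B = unitSign j (B ∆ {j}) • coord n V v (B ∆ {j}) := rfl

theorem unitSign_mul_self (j : Fin n) (A : Finset (Fin n)) :
    unitSign j A * unitSign j A = 1 := by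
  unfold unitSign
  rw [← mul_pow]; simp

theorem unitSign_symmDiff_of_le {i j : Fin n} (h : i ≤ j) (A : Finset (Fin n)) :
    unitSign j (A ∆ {i}) = -unitSign j A := by
  unfold unitSign
  by_cases hi : i ∈ A
  · have h1 : A ∆ {i} = A.erase i := by
      ext x; simp only [Finset.mem_symmDiff, Finset.mem_singleton, Finset.mem_erase]; grind
    have h2 : A.filter (· ≤ j) = insert i ((A.erase i).filter (· ≤ j)) := by
      ext x; simp only [Finset.mem_filter, Finset.mem_insert, Finset.mem_erase]; grind
    rw [h1, h2, Finset.card_insert_of_notMem (by simp), pow_succ]; ring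
  · have h1 : (A ∆ {i}).filter (· ≤ j) = insert i (A.filter (· ≤ j)) := by
      ext x; simp only [Finset.mem_symmDiff, Finset.mem_singleton, Finset.mem_filter,
        Finset.mem_insert]; grind
    rw [h1, Finset.card_insert_of_notMem (by simp [hi]), pow_succ]; ring

theorem unitSign_symmDiff_of_lt {i j : Fin n} (h : j < i) (A : Finset (Fin n)) :
    unitSign j (A ∆ {i}) = unitSign j A := by
  unfold unitSign
  congr 2
  ext x; simp only [Finset.mem_symmDiff, Finset.mem_singleton, Finset.mem_filter]; grind

theorem unitMul_sq (j : Fin n) : unitMul V j * unitMul V j = -1 := by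
  refine ContinuousLinearMap.ext fun v => coord_ext fun B => ?_
  simp only [mul_apply_eq_comp, unitMul_apply, symmDiff_symmDiff_cancel_right,
    smul_smul, unitSign_symmDiff_of_le le_rfl, neg_mul, unitSign_mul_self]
  simp

theorem unitMul_anticomm {i j : Fin n} (h : i < j) :
    unitMul V i * unitMul V j + unitMul V j * unitMul V i = 0 := by
  refine ContinuousLinearMap.ext fun v => coord_ext fun B => ?_
  simp only [add_apply, mul_apply_eq_comp, unitMul_apply,
    map_add, Pi.add_apply, smul_smul]
  rw [symmDiff_right_comm B {j} {i}]
  rw [unitSign_symmDiff_of_lt h (B ∆ {i}), unitSign_symmDiff_of_le le_rfl B,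
    unitSign_symmDiff_of_le le_rfl (B ∆ {i}), unitSign_symmDiff_of_le h.le B,
    unitSign_symmDiff_of_le le_rfl B, ← add_smul]
  simp [mul_comm]

/-- Left multiplication by the vector `∑ x_j e_j` on `Vₙ`. -/
def vectorMul (n : ℕ) (V : Type*) [NormedAddCommGroup V] [NormedSpace ℝ V] :
    (Fin n → ℝ) →ₗ[ℝ] (Vn n V →L[ℝ] Vn n V) :=
  Fintype.linearCombination ℝ (unitMul V)

theorem vectorMul_sq (x : Fin n → ℝ) :
    vectorMul n V x * vectorMul n V x = algebraMap ℝ _ (negSumSq n x) := by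
  have key : ∀ i j : Fin n, unitMul V i * unitMul V j + unitMul V j * unitMul V i =
      if i = j then (-2 : ℝ) • (1 : Vn n V →L[ℝ] Vn n V) else 0 := by
    intro i j
    rcases lt_trichotomy i j with h | rfl | h
    · rw [if_neg h.ne, unitMul_anticomm h]
    · rw [if_pos rfl, unitMul_sq]; module
    · rw [if_neg h.ne', add_comm, unitMul_anticomm h]
  have h1 : vectorMul n V x * vectorMul n V x =
      ∑ i, ∑ j, (x i * x j) • (unitMul V i * unitMul V j) := by
    simp only [vectorMul, Fintype.linearCombination_apply, Finset.sum_mul_sum]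
    exact Finset.sum_congr rfl fun i _ => Finset.sum_congr rfl fun j _ =>
      smul_mul_smul_comm (x i) (unitMul V i) (x j) (unitMul V j)
  have h2 : vectorMul n V x * vectorMul n V x =
      ∑ i, ∑ j, (x i * x j) • (unitMul V j * unitMul V i) := by
    rw [h1, Finset.sum_comm]
    simp only [mul_comm]
  have h3 : (2 : ℝ) • (vectorMul n V x * vectorMul n V x) =
      (2 : ℝ) • algebraMap ℝ (Vn n V →L[ℝ] Vn n V) (negSumSq n x) := by
    rw [two_smul ℝ (vectorMul n V x * vectorMul n V x)]
    nth_rewrite 1 [h1]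
    rw [h2]
    simp only [← Finset.sum_add_distrib, ← smul_add, key]
    simp only [smul_ite, smul_zero, Finset.sum_ite_eq, Finset.mem_univ, if_true, smul_smul]
    rw [← Finset.sum_smul, Algebra.algebraMap_eq_smul_one, smul_smul]
    congr 1
    simp [negSumSq, QuadraticMap.weightedSumSquares_apply, ← Finset.sum_mul]
    ring
  exact smul_right_injective _ (two_ne_zero' ℝ) h3

/-- Left multiplication `v ↦ a v = ∑_A v_A ⊗ (a e_A)` on `Vₙ` by the elements `a` of the Clifford
algebra. Composition with `leftMul n V a` on the right and on the left gives the products `S a` and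
`a S` of an operator `S` with a Clifford number `a`. -/
def leftMul (n : ℕ) (V : Type*) [NormedAddCommGroup V] [NormedSpace ℝ V] :
    RClifford n →ₐ[ℝ] (Vn n V →L[ℝ] Vn n V) :=
  CliffordAlgebra.lift (negSumSq n) ⟨vectorMul n V, vectorMul_sq⟩

theorem leftMul_unit (j : Fin n) : leftMul n V (unit j) = unitMul V j := by
  simp [leftMul, unit, vectorMul, Fintype.linearCombination_apply, Pi.single_apply]

/-- Consistency of the coordinates: `e_A (v ⊗ 1) = v ⊗ e_A`. -/
theorem leftMul_basisElt (A : Finset (Fin n)) (v : V) :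
    leftMul n V (basisElt A) ((coord n V).symm (Pi.single ∅ v)) =
      (coord n V).symm (Pi.single A v) := by
  induction A using Finset.induction_on_min with
  | empty => simp [basisElt]
  | insert j A hA ih =>
    have hj : j ∉ A := fun h => lt_irrefl _ (hA j h)
    have h1 : basisElt (insert j A) = unit j * basisElt A := by
      unfold basisElt
      rw [Finset.sort_insert (r := (· ≤ ·)) (fun b hb => (hA b hb).le) hj]
      simp
    rw [h1, map_mul, mul_apply_eq_comp, ih, leftMul_unit]
    have h2 : insert j A = A ∆ {j} := by
      ext x; simp only [Finset.mem_symmDiff, Finset.mem_singleton, Finset.mem_insert]; grind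
    have h3 : unitSign j A = 1 := by
      unfold unitSign
      rw [Finset.filter_false_of_mem (fun x hx => not_le.mpr (hA x hx))]; simp
    refine coord_ext fun B => ?_
    rw [unitMul_apply, h2]
    by_cases hB : B = A ∆ {j}
    · subst hB
      simp [h3]
    · have hB' : B ∆ {j} ≠ A := fun h => hB (by rw [← h, symmDiff_symmDiff_cancel_right])
      simp [hB, hB']

/-! ### Paravector operators and the `S`-spectrum -/

/-- `𝓑^{0,1}(Vₙ)`: the operators `T = T₀ + e₁ T₁ + ⋯ + eₙ Tₙ` on `Vₙ` with bounded `ℝ`-linear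
components `T_j` on `V`, which need not commute. -/
def paravectorOperators (n : ℕ) (V : Type*) [NormedAddCommGroup V] [NormedSpace ℝ V] :
    Set (Vn n V →L[ℝ] Vn n V) :=
  {T | ∃ (T₀ : V →L[ℝ] V) (T' : Fin n → (V →L[ℝ] V)),
    T = coordwise n T₀ + ∑ j, leftMul n V (unit j) * coordwise n (T' j)}

/-- `T² - 2 s₀ T + |s|² 𝓘`. -/
def quadOp (s : Paravector n) (T : Vn n V →L[ℝ] Vn n V) : Vn n V →L[ℝ] Vn n V :=
  T ^ 2 - (2 * s 0) • T + (‖s‖ ^ 2) • (1 : Vn n V →L[ℝ] Vn n V)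

/-- The `S`-spectrum of `T`. -/
def sSpectrum (T : Vn n V →L[ℝ] Vn n V) : Set (Paravector n) :=
  {s | ¬ IsUnit (quadOp s T)}

/-- The distance `inf {|s - p| : s ∈ A, p ∈ B}` of two sets, equal to `∞` if one is empty. -/
def setDist (A B : Set (Paravector n)) : ENNReal :=
  ⨅ s ∈ A, ⨅ p ∈ B, edist s p

/-! ### Slice hyperholomorphic products

Polynomials `∑ T^k a_k` (coefficients on the right) and `∑ a_k T^k` (coefficients on the left) in
the operator `T` are recorded by their coefficients, as elements of `ℝₙ[X]`, where `X` commutes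
with the coefficients. The `k`-th coefficient of a product in `ℝₙ[X]` is `∑_{i ≤ k} a_i b_{k-i}`;
thus the product of `ℝₙ[X]` is the `⋆_ℓ`-product for polynomials `∑ T^k a_k`, and it is the
`⋆_r`-product for polynomials `∑ a_k T^k`. -/

/-- The operator `∑ T^k a_k`. -/
def evalCoeffRight (T : Vn n V →L[ℝ] Vn n V) (p : Polynomial (RClifford n)) :
    Vn n V →L[ℝ] Vn n V :=
  p.sum (fun k a => T ^ k * leftMul n V a)

/-- The operator `∑ a_k T^k`. -/
def evalCoeffLeft (T : Vn n V →L[ℝ] Vn n V) (p : Polynomial (RClifford n)) :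
    Vn n V →L[ℝ] Vn n V :=
  p.sum (fun k a => leftMul n V a * T ^ k)

/-- The coefficients of `s 𝓘 - T`. -/
def linearFactor (s : Paravector n) : Polynomial (RClifford n) :=
  Polynomial.C s.toClifford - Polynomial.X

/-- `S_L^{-m}(s,T) ⋆_ℓ S_L^{-k}(s̄,T)
  = (T² - 2 s₀ T + |s|² 𝓘)^{-(m+k)} [(s̄ 𝓘 - T)^{⋆_ℓ m} ⋆_ℓ (s 𝓘 - T)^{⋆_ℓ k}]`,
for `s` outside the `S`-spectrum of `T`. -/
def leftResolventStar (T : Vn n V →L[ℝ] Vn n V) (s : Paravector n) (m k : ℕ) :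
    Vn n V →L[ℝ] Vn n V :=
  Ring.inverse (quadOp s T) ^ (m + k) *
    evalCoeffRight T (linearFactor s.conj ^ m * linearFactor s ^ k)

/-- `S_R^{-m}(s,T) ⋆_r S_R^{-k}(s̄,T)
  = [(s̄ 𝓘 - T)^{⋆_r m} ⋆_r (s 𝓘 - T)^{⋆_r k}] (T² - 2 s₀ T + |s|² 𝓘)^{-(m+k)}`,
for `s` outside the `S`-spectrum of `T`. -/
def rightResolventStar (T : Vn n V →L[ℝ] Vn n V) (s : Paravector n) (m k : ℕ) :
    Vn n V →L[ℝ] Vn n V :=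
  evalCoeffLeft T (linearFactor s.conj ^ m * linearFactor s ^ k) *
    Ring.inverse (quadOp s T) ^ (m + k)

end Operators

end SFunctionalCalculus

end

/-! ### Power bounds for resolvents in complex Banach algebras -/

open Filter Topology ComplexConjugate

/-! Write `s = x + y u` with `u` a unit vector and put `z = x + i y`. The coefficients of both star
factors lie in the commutative slice `ℝ + ℝ u ≅ ℂ`, so the star product is a product of complex
polynomials. On the complexification, `Q_s(T)` becomes `(z - T)(z̄ - T)`, and `R(z)^m R(z̄)^n` (`R`
the resolvent of the extended `T`) splits as `A + i B` with real operators `A`, `B`. The left star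
resolvent is `A + B u`, the right one `A + u B`, and `A`, `B` are bounded by the norm of `A + i B`
(`norm_resolventStar_le`). It remains to bound `‖R(z)^m‖` by `K / ε^m` uniformly
(`exists_bound_resolvent_pow`). The distance hypothesis keeps `z` and `z̄` at distance `δ > ε` from
the complex spectrum, so `R(z)` has spectral radius at most `1/δ < 1/ε`. Gelfand's formula gives a
power `N` with `‖R(z)^N‖ < ε^{-N}`. This condition is open in `z`, so compactness gives uniformity
on bounded sets, and the decay of `R` at infinity covers the rest. -/

theorem exists_bound_pow_of_pow_lt {A : Type*} [SeminormedRing A] {ε M : ℝ} (hε : 0 < ε) {N : ℕ}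
    (hN : 0 < N) : ∃ K : ℝ, 0 ≤ K ∧ ∀ a : A, ‖a‖ ≤ M → ‖a ^ N‖ ≤ (ε ^ N)⁻¹ →
      ∀ m : ℕ, ‖a ^ m‖ ≤ K / ε ^ m := by
  -- `L` dominates both `1` and `ε‖a‖`, so `L ^ N` bounds `(ε‖a‖)^m` for `0 < m < N`. The term with
  -- `‖1‖` is for `m = 0`, since `‖1‖` need not be `1`. The constant is independent of `a`.
  set L : ℝ := 1 + max 0 (ε * M) with hL
  have hL1 : 1 ≤ L := by simp [hL]
  have hML : ε * M ≤ L := (le_max_right 0 _).trans (by linarith)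
  refine ⟨L ^ N + ‖(1 : A)‖ * L ^ N, by positivity, fun a ha haN m => ?_⟩
  induction m using Nat.strong_induction_on with
  | _ m ih =>
    by_cases hm : m < N
    · rw [le_div_iff₀ (by positivity)]
      rcases Nat.eq_zero_or_pos m with rfl | hm0
      · simp only [pow_zero, mul_one]
        nlinarith [norm_nonneg (1 : A), one_le_pow₀ hL1 (n := N)]
      · calc ‖a ^ m‖ * ε ^ m ≤ ‖a‖ ^ m * ε ^ m := by gcongr; exact norm_pow_le' a hm0
          _ = (ε * ‖a‖) ^ m := by rw [mul_pow, mul_comm]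
          _ ≤ L ^ m := by gcongr; exact (by gcongr : ε * ‖a‖ ≤ ε * M).trans hML
          _ ≤ L ^ N := pow_le_pow_right₀ hL1 hm.le
          _ ≤ _ := by have := norm_nonneg (1 : A); have : 0 ≤ ‖(1 : A)‖ * L ^ N := by positivity
                      linarith
    -- Splitting off a block `a ^ N` costs exactly `ε^{-N}`, so the constant does not grow.
    · obtain ⟨k, rfl⟩ := Nat.exists_eq_add_of_le (not_lt.mp hm)
      calc ‖a ^ (N + k)‖ ≤ ‖a ^ N‖ * ‖a ^ k‖ := by rw [pow_add]; exact norm_mul_le _ _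
        _ ≤ (ε ^ N)⁻¹ * ((L ^ N + ‖(1 : A)‖ * L ^ N) / ε ^ k) := by
          gcongr; exact ih k (by omega)
        _ = _ := by rw [pow_add]; field_simp

section ResolventPowers

variable {A : Type*} [NormedRing A] [NormedAlgebra ℂ A]

theorem mem_resolventSet_of_le_norm_sub {a : A} {δ : ℝ} (hδ : 0 < δ) {z : ℂ}
    (hz : ∀ ζ ∈ spectrum ℂ a, δ ≤ ‖z - ζ‖) : z ∈ resolventSet ℂ a := by
  by_contra h
  have := hz z h
  simp at this
  linarith

/-- Spectral mapping for inverses: if `k` is in the spectrum of `(z - a)⁻¹`, then `z - k⁻¹` is in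
that of `a`, whence `δ ≤ |k|⁻¹`. -/
theorem spectralRadius_resolvent_le {a : A} {δ : ℝ} (hδ : 0 < δ) {z : ℂ}
    (hz : ∀ ζ ∈ spectrum ℂ a, δ ≤ ‖z - ζ‖) :
    spectralRadius ℂ (resolvent a z) ≤ ENNReal.ofReal δ⁻¹ := by
  obtain ⟨u, hu⟩ := mem_resolventSet_of_le_norm_sub hδ hz
  have hr : resolvent a z = (↑u⁻¹ : A) := by rw [resolvent, ← hu, Ring.inverse_unit]
  refine iSup₂_le fun k hk => ?_
  rw [hr] at hk
  have hk0 : k ≠ 0 := by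
    rintro rfl
    exact spectrum.zero_notMem ℂ u⁻¹.isUnit hk
  have h1 : k⁻¹ ∈ spectrum ℂ (algebraMap ℂ A z - a) := by
    have := (spectrum.inv_mem_iff (R := ℂ) (r := Units.mk0 k⁻¹ (inv_ne_zero hk0)) (a := u)).2
    rw [← hu]
    apply this
    simpa using hk
  have h2 : z - k⁻¹ ∈ spectrum ℂ a := by
    rw [spectrum.mem_iff] at h1 ⊢
    intro h
    apply h1
    rw [← IsUnit.neg_iff]
    convert h using 1
    rw [map_sub]; abel
  have h3 := hz _ h2
  rw [sub_sub_cancel, norm_inv] at h3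
  rw [← enorm_eq_nnnorm, ← ofReal_norm]
  apply ENNReal.ofReal_le_ofReal
  rwa [le_inv_comm₀ (norm_pos_iff.2 hk0) hδ]

variable [CompleteSpace A]

/-- Gelfand's formula. The inequality is strict so that it persists, with the same `N`, near `z`. -/
theorem exists_norm_resolvent_pow_lt {a : A} {ε δ : ℝ} (hε : 0 < ε) (hεδ : ε < δ) {z : ℂ}
    (hz : ∀ ζ ∈ spectrum ℂ a, δ ≤ ‖z - ζ‖) :
    ∃ N : ℕ, 0 < N ∧ ‖resolvent a z ^ N‖ < (ε ^ N)⁻¹ := by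
  have hδ := hε.trans hεδ
  have h1 := spectrum.pow_nnnorm_pow_one_div_tendsto_nhds_spectralRadius (resolvent a z)
  have h2 : spectralRadius ℂ (resolvent a z) < ENNReal.ofReal ε⁻¹ :=
    (spectralRadius_resolvent_le hδ hz).trans_lt
      ((ENNReal.ofReal_lt_ofReal_iff (by positivity)).2 (by gcongr))
  obtain ⟨N, hN, hN0⟩ := ((h1.eventually_lt_const h2).and (eventually_gt_atTop 0)).exists
  refine ⟨N, hN0, ?_⟩
  have hN' : (N : ℝ) ≠ 0 := by positivity
  have h3 := ENNReal.rpow_lt_rpow hN (show (0 : ℝ) < N by positivity)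
  rw [← ENNReal.rpow_mul, one_div_mul_cancel hN', ENNReal.rpow_one, ENNReal.rpow_natCast,
    ← ENNReal.ofReal_pow (by positivity), ← enorm_eq_nnnorm, ← ofReal_norm] at h3
  rw [← inv_pow]
  exact lt_of_not_ge fun h => h3.not_ge (ENNReal.ofReal_le_ofReal h)

theorem exists_bound_resolvent_pow (a : A) {ε δ : ℝ} (hε : 0 < ε) (hεδ : ε < δ) :
    ∃ K : ℝ, 0 ≤ K ∧ ∀ z : ℂ, (∀ ζ ∈ spectrum ℂ a, δ ≤ ‖z - ζ‖) →
      ∀ m : ℕ, ‖resolvent a z ^ m‖ ≤ K / ε ^ m := by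
  have hδ := hε.trans hεδ
  set S : Set ℂ := {z | ∀ ζ ∈ spectrum ℂ a, δ ≤ ‖z - ζ‖} with hS
  have hSc : IsClosed S := by
    simp only [hS, Set.ofPred_forall]
    exact isClosed_biInter fun ζ _ => isClosed_le continuous_const (by fun_prop)
  have hlim := (spectrum.resolvent_tendsto_cobounded (𝕜 := ℂ) a).norm
  rw [norm_zero] at hlim
  have hlarge := hlim.eventually_lt_const (inv_pos.2 hε)
  obtain ⟨r, hr⟩ := (hasBasis_cobounded_norm (E := ℂ)).eventually_iff.1 hlarge
  obtain ⟨K₁, hK₁, h₁⟩ := exists_bound_pow_of_pow_lt (A := A) (M := ε⁻¹) hε one_pos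
  have hcpt : IsCompact (S ∩ Metric.closedBall 0 r) :=
    (isCompact_closedBall 0 r).inter_left hSc
  obtain ⟨K₂, hK₂, h₂⟩ : ∃ K : ℝ, 0 ≤ K ∧ ∀ z ∈ S ∩ Metric.closedBall 0 r,
      ∀ m : ℕ, ‖resolvent a z ^ m‖ ≤ K / ε ^ m := by
    -- Having a uniform bound passes to subsets and finite unions, so it only has to be checked
    -- locally.
    refine hcpt.induction_on (p := fun s => ∃ K : ℝ, 0 ≤ K ∧ ∀ z ∈ s,
      ∀ m : ℕ, ‖resolvent a z ^ m‖ ≤ K / ε ^ m) ⟨0, le_rfl, by simp⟩ ?_ ?_ ?_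
    · rintro s t hst ⟨K, hK, h⟩
      exact ⟨K, hK, fun z hz => h z (hst hz)⟩
    · rintro s t ⟨K, hK, h⟩ ⟨K', hK', h'⟩
      refine ⟨K + K', by positivity, ?_⟩
      rintro z (hz | hz) m
      · exact (h z hz m).trans (by gcongr; linarith)
      · exact (h' z hz m).trans (by gcongr; linarith)
    · rintro z ⟨hz, -⟩
      obtain ⟨N, hN0, hN⟩ := exists_norm_resolvent_pow_lt hε hεδ hz
      have hcont : ContinuousAt (resolvent a) z :=
        (spectrum.hasDerivAt_resolvent_const_left (mem_resolventSet_of_le_norm_sub hδ hz)).continuousAt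
      obtain ⟨K, hK, h⟩ := exists_bound_pow_of_pow_lt (A := A) (M := ‖resolvent a z‖ + 1) hε hN0
      refine ⟨{w | ‖resolvent a w‖ ≤ ‖resolvent a z‖ + 1 ∧ ‖resolvent a w ^ N‖ ≤ (ε ^ N)⁻¹},
        mem_nhdsWithin_of_mem_nhds ?_, K, hK, fun w hw => h _ hw.1 hw.2⟩
      filter_upwards [hcont.norm.eventually_lt_const (lt_add_one _),
        (hcont.pow N).norm.eventually_lt_const hN] with w hw hw'
      exact ⟨hw.le, hw'.le⟩
  refine ⟨K₁ + K₂, by positivity, fun z hz m => ?_⟩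
  by_cases hzr : ‖z‖ ≤ r
  · exact (h₂ z ⟨hz, by simpa using hzr⟩ m).trans (by gcongr; linarith)
  · have := hr.2 (show z ∈ {x | r ≤ ‖x‖} from (not_le.1 hzr).le)
    exact (h₁ _ this.le (by simpa using this.le) m).trans (by gcongr; linarith)

end ResolventPowers

/-! ### Complexification of a real Banach space -/

noncomputable section

/-- The complexification `ℂ ⊗ X` of a real normed space, realised as `Hom_ℝ(ℂ, X)` with the
operator norm and `(z • f) w = f (w z)`. -/
def Complexification (X : Type*) [NormedAddCommGroup X] [NormedSpace ℝ X] : Type _ := ℂ →L[ℝ] X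

namespace Complexification

variable {X : Type*} [NormedAddCommGroup X] [NormedSpace ℝ X]

instance : NormedAddCommGroup (Complexification X) :=
  inferInstanceAs (NormedAddCommGroup (ℂ →L[ℝ] X))

instance [CompleteSpace X] : CompleteSpace (Complexification X) :=
  inferInstanceAs (CompleteSpace (ℂ →L[ℝ] X))

instance : FunLike (Complexification X) ℂ X :=
  inferInstanceAs (FunLike (ℂ →L[ℝ] X) ℂ X)

@[ext] theorem ext {f g : Complexification X} (h : ∀ w, f w = g w) : f = g :=
  ContinuousLinearMap.ext h

instance : SMul ℂ (Complexification X) where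
  smul z f := ContinuousLinearMap.comp (show ℂ →L[ℝ] X from f) (ContinuousLinearMap.mul ℝ ℂ z)

@[simp] theorem smul_apply (z : ℂ) (f : Complexification X) (w : ℂ) : (z • f) w = f (z * w) := rfl
@[simp] theorem add_apply (f g : Complexification X) (w : ℂ) : (f + g) w = f w + g w := rfl
@[simp] theorem zero_apply (w : ℂ) : (0 : Complexification X) w = 0 := rfl
theorem map_add' (f : Complexification X) (v w : ℂ) : f (v + w) = f v + f w :=
  ContinuousLinearMap.map_add f v w
theorem map_zero' (f : Complexification X) : f 0 = 0 := ContinuousLinearMap.map_zero f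
theorem map_real_mul (f : Complexification X) (r : ℝ) (w : ℂ) : f (r * w) = r • f w := by
  rw [← Complex.real_smul]; exact ContinuousLinearMap.map_smul f r w

theorem norm_apply_le (f : Complexification X) (w : ℂ) : ‖f w‖ ≤ ‖f‖ * ‖w‖ :=
  ContinuousLinearMap.le_opNorm f w

theorem norm_le_of_forall {f : Complexification X} {M : ℝ} (hM : 0 ≤ M)
    (h : ∀ w, ‖f w‖ ≤ M * ‖w‖) : ‖f‖ ≤ M :=
  ContinuousLinearMap.opNorm_le_bound f hM h

instance : Module ℂ (Complexification X) where
  one_smul f := by ext w; simp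
  mul_smul x y f := by ext w; simp [mul_left_comm, mul_assoc]
  smul_zero x := by ext w; simp
  smul_add x f g := by ext w; simp
  add_smul x y f := by ext w; simp [add_mul, map_add']
  zero_smul f := by ext w; simp [map_zero']

instance : NormedSpace ℂ (Complexification X) where
  norm_smul_le z f := norm_le_of_forall (by positivity) fun w => by
    rw [smul_apply, mul_comm ‖z‖, mul_assoc, ← norm_mul]
    exact norm_apply_le f _

/-- The element `1 ⊗ x`. -/
def ofReal (x : X) : Complexification X := ContinuousLinearMap.smulRight Complex.reCLM x

@[simp] theorem ofReal_apply (x : X) (w : ℂ) : ofReal x w = w.re • x := rfl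

theorem norm_ofReal_le (x : X) : ‖ofReal x‖ ≤ ‖x‖ :=
  norm_le_of_forall (norm_nonneg _) fun w => by
    rw [ofReal_apply, norm_smul, mul_comm]
    gcongr
    exact Complex.abs_re_le_norm w

/-- The complex-linear extension of a bounded operator, as a ring homomorphism. -/
def extend : (X →L[ℝ] X) →+* (Complexification X →L[ℂ] Complexification X) where
  toFun S := LinearMap.mkContinuous
    { toFun := fun f => ContinuousLinearMap.comp S (show ℂ →L[ℝ] X from f)
      map_add' := fun _ _ => ContinuousLinearMap.comp_add S _ _
      map_smul' := fun _ _ => rfl } ‖S‖ fun f => ContinuousLinearMap.opNorm_comp_le S f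
  map_one' := rfl
  map_mul' _ _ := rfl
  map_zero' := rfl
  map_add' _ _ := rfl

@[simp] theorem extend_apply (S : X →L[ℝ] X) (f : Complexification X) (w : ℂ) :
    extend S f w = S (f w) := rfl

theorem extend_smul (r : ℝ) (S : X →L[ℝ] X) : extend (r • S) = (r : ℂ) • extend S := by
  refine ContinuousLinearMap.ext fun f => Complexification.ext fun w => ?_
  change r • S (f w) = S (f (r * w))
  rw [map_real_mul, map_smul]

/-- Bijectivity is tested on the vectors `1 ⊗ x`; evaluating a preimage of `1 ⊗ x` at `1` gives a
preimage of `x`. -/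
theorem isUnit_of_isUnit_extend [CompleteSpace X] {S : X →L[ℝ] X} (h : IsUnit (extend S)) :
    IsUnit S := by
  have hb := ContinuousLinearMap.isUnit_iff_bijective.1 h
  refine ContinuousLinearMap.isUnit_iff_bijective.2 ⟨?_, fun x => ?_⟩
  · intro x y hxy
    have : ofReal x = ofReal y := hb.1 (by ext w; simp [hxy])
    simpa using congrArg (fun f : Complexification X => f 1) this
  · obtain ⟨f, hf⟩ := hb.2 (ofReal x)
    exact ⟨f 1, by simpa using congrArg (fun f : Complexification X => f 1) hf⟩

/-- Evaluation at `w = 1` isolates `S` and at `w = i` isolates `-S'`. As `|w| = 1` and `‖1 ⊗ x‖ ≤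
‖x‖`, both norms are controlled with constant `1`. -/
theorem extend_add_I_smul_ofReal (S S' : X →L[ℝ] X) (x : X) (w : ℂ) :
    (extend S + Complex.I • extend S') (ofReal x) w = w.re • S x - w.im • S' x := by
  change S (ofReal x w) + S' (ofReal x (Complex.I * w)) = _
  simp [sub_eq_add_neg]

theorem norm_le_norm_extend_add_left (S S' : X →L[ℝ] X) :
    ‖S‖ ≤ ‖extend S + Complex.I • extend S'‖ := by
  refine ContinuousLinearMap.opNorm_le_bound _ (norm_nonneg _) fun x => ?_
  have h := extend_add_I_smul_ofReal S S' x 1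
  simp only [Complex.one_re, one_smul, Complex.one_im, zero_smul, sub_zero] at h
  rw [← h]
  refine (norm_apply_le _ _).trans ?_
  rw [norm_one, mul_one]
  refine (ContinuousLinearMap.le_opNorm _ _).trans ?_
  gcongr
  exact norm_ofReal_le x

theorem norm_le_norm_extend_add_right (S S' : X →L[ℝ] X) :
    ‖S'‖ ≤ ‖extend S + Complex.I • extend S'‖ := by
  refine ContinuousLinearMap.opNorm_le_bound _ (norm_nonneg _) fun x => ?_
  have h := extend_add_I_smul_ofReal S S' x Complex.I
  simp only [Complex.I_re, one_smul, Complex.I_im, zero_smul, zero_sub] at h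
  rw [← norm_neg, ← h]
  refine (norm_apply_le _ _).trans ?_
  rw [Complex.norm_I, mul_one]
  refine (ContinuousLinearMap.le_opNorm _ _).trans ?_
  gcongr
  exact norm_ofReal_le x

end Complexification

end

noncomputable section

namespace Complexification

variable {X : Type*} [NormedAddCommGroup X] [NormedSpace ℝ X]

/-- The operator `∑ Re(c_k) T^k` for a complex polynomial `∑ c_k X^k`. -/
def reEval (T : X →L[ℝ] X) (P : Polynomial ℂ) : X →L[ℝ] X := P.sum fun k c => c.re • T ^ k

/-- The operator `∑ Im(c_k) T^k` for a complex polynomial `∑ c_k X^k`. -/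
def imEval (T : X →L[ℝ] X) (P : Polynomial ℂ) : X →L[ℝ] X := P.sum fun k c => c.im • T ^ k

theorem aeval_extend (T : X →L[ℝ] X) (P : Polynomial ℂ) :
    Polynomial.aeval (extend T) P =
      extend (reEval T P) + Complex.I • extend (imEval T P) := by
  rw [Polynomial.aeval_def, Polynomial.eval₂_eq_sum, reEval, imEval, Polynomial.sum,
    Polynomial.sum, Polynomial.sum, map_sum, map_sum, Finset.smul_sum, ← Finset.sum_add_distrib]
  refine Finset.sum_congr rfl fun k _ => ?_
  rw [extend_smul, extend_smul, smul_smul, ← add_smul, map_pow, ← Algebra.smul_def, mul_comm,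
    Complex.re_add_im]

end Complexification

open Complexification

/-- Applied with `x = z - T` and `y = z̄ - T`, this turns the defining formula of the star
resolvents into `R(z)^m R(z̄)^n`. -/
theorem Commute.mul_inv_pow_mul {G : Type*} [Group G] {x y : G} (h : Commute x y) (m n : ℕ) :
    ((x * y)⁻¹) ^ (m + n) * (y ^ m * x ^ n) = x⁻¹ ^ m * y⁻¹ ^ n := by
  have h1 : Commute (y ^ (m + n)) (x⁻¹ ^ m) := (h.symm.inv_right).pow_pow _ _
  rw [inv_pow, inv_mul_eq_iff_eq_mul, h.mul_pow, (h.symm.pow_pow m n).eq, mul_assoc,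
    ← mul_assoc (y ^ (m + n)), h1.eq, mul_assoc, ← mul_assoc, pow_add y, add_comm m n, pow_add x]
  simp

/-! ### Complex slices of the paravectors and of the Clifford algebra -/

namespace SFunctionalCalculus

variable {d : ℕ}

theorem sum_smul_unit (x : Fin d → ℝ) :
    ∑ j, x j • (unit j : RClifford d) = CliffordAlgebra.ι (negSumSq d) x := by
  conv_rhs => rw [← Finset.univ_sum_single x]
  rw [map_sum]
  refine Finset.sum_congr rfl fun j _ => ?_
  rw [unit, ← map_smul, ← Pi.single_smul]; simp

/-- The paravector `x + y u` for the complex number `x + i y` and `u ∈ ℝᵈ`. -/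
def Paravector.ofComplex (u : Fin d → ℝ) (z : ℂ) : Paravector d :=
  WithLp.toLp 2 (Fin.cons z.re fun j => z.im * u j)

@[simp] theorem Paravector.ofComplex_zero (u : Fin d → ℝ) (z : ℂ) :
    Paravector.ofComplex u z 0 = z.re := rfl

@[simp] theorem Paravector.ofComplex_succ (u : Fin d → ℝ) (z : ℂ) (j : Fin d) :
    Paravector.ofComplex u z j.succ = z.im * u j := rfl

/-- This gives the distance estimate at `z̄` from the same point of `C`, with no symmetry of `C`
required. -/
theorem Paravector.ofComplex_neg_conj (u : Fin d → ℝ) (z : ℂ) :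
    Paravector.ofComplex (-u) (conj z) = Paravector.ofComplex u z := by
  ext i; refine Fin.cases ?_ (fun j => ?_) i <;> simp

theorem Paravector.conj_ofComplex (u : Fin d → ℝ) (z : ℂ) :
    (Paravector.ofComplex u z).conj = Paravector.ofComplex u (conj z) := by
  ext i; refine Fin.cases ?_ (fun j => ?_) i <;> simp [Paravector.conj]

theorem Paravector.norm_sq_ofComplex {u : Fin d → ℝ} (hu : ∑ j, u j ^ 2 = 1) (z : ℂ) :
    ‖Paravector.ofComplex u z‖ ^ 2 = ‖z‖ ^ 2 := by
  rw [EuclideanSpace.norm_sq_eq, Fin.sum_univ_succ, Complex.sq_norm, Complex.normSq_apply]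
  simp [mul_pow, ← Finset.mul_sum, hu]
  ring

theorem Paravector.dist_ofComplex {u : Fin d → ℝ} (hu : ∑ j, u j ^ 2 = 1) (z ζ : ℂ) :
    dist (Paravector.ofComplex u z) (Paravector.ofComplex u ζ) = ‖z - ζ‖ := by
  have : Paravector.ofComplex u z - Paravector.ofComplex u ζ = Paravector.ofComplex u (z - ζ) := by
    ext i; refine Fin.cases ?_ (fun j => ?_) i <;> simp [sub_mul]
  rw [dist_eq_norm, this, ← abs_norm, ← abs_norm (z - ζ), ← sq_eq_sq_iff_abs_eq_abs,
    Paravector.norm_sq_ofComplex hu]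

theorem Paravector.exists_eq_ofComplex (hd : 1 ≤ d) (s : Paravector d) :
    ∃ (u : Fin d → ℝ) (z : ℂ), ∑ j, u j ^ 2 = 1 ∧ s = Paravector.ofComplex u z := by
  set r : ℝ := √(∑ j : Fin d, s j.succ ^ 2) with hr
  have hr2 : r ^ 2 = ∑ j : Fin d, s j.succ ^ 2 := Real.sq_sqrt (by positivity)
  by_cases h0 : r = 0
  -- A real `s` lies on every slice; `1 ≤ d` provides one.
  · refine ⟨Pi.single ⟨0, hd⟩ 1, ⟨s 0, 0⟩, by simp [Pi.single_apply], ?_⟩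
    have h : ∀ j : Fin d, s j.succ = 0 := by
      rw [h0, eq_comm, zero_pow two_ne_zero, Finset.sum_eq_zero_iff_of_nonneg
        (fun _ _ => sq_nonneg _)] at hr2
      exact fun j => by simpa using hr2 j (Finset.mem_univ j)
    ext i; refine Fin.cases ?_ (fun j => ?_) i <;> simp [h]
  · refine ⟨fun j => s j.succ / r, ⟨s 0, r⟩, ?_, ?_⟩
    · simp_rw [div_pow, ← Finset.sum_div, ← hr2]
      exact div_self (pow_ne_zero 2 h0)
    · ext i; refine Fin.cases ?_ (fun j => ?_) i <;> simp [mul_div_cancel₀ _ h0]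

theorem ι_mul_self_of_sum_sq {u : Fin d → ℝ} (hu : ∑ j, u j ^ 2 = 1) :
    CliffordAlgebra.ι (negSumSq d) u * CliffordAlgebra.ι (negSumSq d) u = -1 := by
  rw [CliffordAlgebra.ι_sq_scalar]
  have : negSumSq d u = -1 := by
    rw [← hu]
    simp [negSumSq, QuadraticMap.weightedSumSquares_apply, pow_two]
  simp [this]

/-- The embedding of `ℂ` onto the slice `ℝ + ℝ u` of the Clifford algebra, `|u| = 1`. -/
def sliceHom {u : Fin d → ℝ} (hu : ∑ j, u j ^ 2 = 1) : ℂ →ₐ[ℝ] RClifford d :=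
  Complex.liftAux (CliffordAlgebra.ι (negSumSq d) u) (ι_mul_self_of_sum_sq hu)

theorem sliceHom_apply {u : Fin d → ℝ} (hu : ∑ j, u j ^ 2 = 1) (z : ℂ) :
    sliceHom hu z = algebraMap ℝ _ z.re + z.im • CliffordAlgebra.ι (negSumSq d) u := rfl

theorem linearFactor_ofComplex {u : Fin d → ℝ} (hu : ∑ j, u j ^ 2 = 1) (z : ℂ) :
    linearFactor (Paravector.ofComplex u z) =
      (Polynomial.C z - Polynomial.X).map (sliceHom hu : ℂ →+* RClifford d) := by
  have : (Paravector.ofComplex u z).toClifford = sliceHom hu z := by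
    rw [sliceHom_apply, Paravector.toClifford, ← sum_smul_unit, Finset.smul_sum]
    simp [smul_smul]
  simp [linearFactor, this]

/-! ### From star resolvents to complex resolvents -/

variable {V : Type*} [NormedAddCommGroup V] [NormedSpace ℝ V]

/-- Only the real parts of the coefficients `a + b u` move past `T ^ k`; `u` need not commute with
`T` and stays on its side. -/
theorem evalCoeffRight_map {u : Fin d → ℝ} (hu : ∑ j, u j ^ 2 = 1) (T : Vn d V →L[ℝ] Vn d V)
    (P : Polynomial ℂ) :
    evalCoeffRight T (P.map (sliceHom hu : ℂ →+* RClifford d)) =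
      reEval T P + imEval T P * leftMul d V (CliffordAlgebra.ι (negSumSq d) u) := by
  rw [evalCoeffRight, Polynomial.sum_eq_of_subset _ (by simp) (Polynomial.support_map_subset _ P),
    reEval, imEval, Polynomial.sum, Polynomial.sum, Finset.sum_mul, ← Finset.sum_add_distrib]
  refine Finset.sum_congr rfl fun k _ => ?_
  rw [Polynomial.coeff_map, RingHom.coe_coe, sliceHom_apply, map_add, map_smul, AlgHom.commutes,
    mul_add, mul_smul_comm, smul_mul_assoc, Algebra.algebraMap_eq_smul_one, mul_smul_comm, mul_one]

theorem evalCoeffLeft_map {u : Fin d → ℝ} (hu : ∑ j, u j ^ 2 = 1) (T : Vn d V →L[ℝ] Vn d V)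
    (P : Polynomial ℂ) :
    evalCoeffLeft T (P.map (sliceHom hu : ℂ →+* RClifford d)) =
      reEval T P + leftMul d V (CliffordAlgebra.ι (negSumSq d) u) * imEval T P := by
  rw [evalCoeffLeft, Polynomial.sum_eq_of_subset _ (by simp) (Polynomial.support_map_subset _ P),
    reEval, imEval, Polynomial.sum, Polynomial.sum, Finset.mul_sum, ← Finset.sum_add_distrib]
  refine Finset.sum_congr rfl fun k _ => ?_
  rw [Polynomial.coeff_map, RingHom.coe_coe, sliceHom_apply, map_add, map_smul, AlgHom.commutes,
    add_mul, mul_smul_comm, smul_mul_assoc, Algebra.algebraMap_eq_smul_one, smul_mul_assoc, one_mul]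

theorem norm_leftMul_ι_le {u : Fin d → ℝ} (hu : ∑ j, u j ^ 2 = 1) :
    ‖leftMul d V (CliffordAlgebra.ι (negSumSq d) u)‖ ≤ ∑ j, ‖unitMul (n := d) V j‖ := by
  rw [← sum_smul_unit, map_sum]
  refine norm_sum_le_of_le _ fun j _ => ?_
  rw [map_smul, leftMul_unit, norm_smul]
  have : ‖u j‖ ≤ 1 := by
    rw [Real.norm_eq_abs, ← sq_le_one_iff_abs_le_one, ← hu]
    exact Finset.single_le_sum (f := fun j => u j ^ 2) (fun _ _ => sq_nonneg _) (Finset.mem_univ j)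
  exact mul_le_of_le_one_left (norm_nonneg _) this

/-- Since `2 s₀ = z + z̄` and `|s|² = z z̄`, the real quadratic factors over `ℂ`. -/
theorem extend_quadOp_ofComplex {u : Fin d → ℝ} (hu : ∑ j, u j ^ 2 = 1) (z : ℂ)
    (T : Vn d V →L[ℝ] Vn d V) :
    extend (quadOp (Paravector.ofComplex u z) T) =
      (algebraMap ℂ _ z - extend T) * (algebraMap ℂ _ (conj z) - extend T) := by
  have h1 : ((2 * z.re : ℝ) : ℂ) = z + conj z := by rw [Complex.add_conj]
  have h2 : ((‖z‖ ^ 2 : ℝ) : ℂ) = z * conj z := by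
    rw [Complex.mul_conj, Complex.normSq_eq_norm_sq]
  rw [quadOp, map_add, map_sub, map_pow, extend_smul, extend_smul, map_one,
    Paravector.norm_sq_ofComplex hu, Paravector.ofComplex_zero, h1, h2]
  simp only [Algebra.algebraMap_eq_smul_one, sub_mul, mul_sub, smul_mul_assoc, mul_smul_comm,
    one_mul, mul_one, pow_two, add_smul, smul_sub, ← mul_smul]
  rw [mul_comm z]
  abel

theorem commute_algebraMap_sub {A : Type*} [Ring A] [Algebra ℂ A] (a : A) (z w : ℂ) :
    Commute (algebraMap ℂ A z - a) (algebraMap ℂ A w - a) :=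
  ((Algebra.commute_algebraMap_left z _).sub_right (Algebra.commute_algebraMap_left z _)).sub_left
    ((Algebra.commute_algebraMap_right w a).sub_right (Commute.refl a))

theorem ofComplex_mem_sSpectrum {u : Fin d → ℝ} (hu : ∑ j, u j ^ 2 = 1)
    {T : Vn d V →L[ℝ] Vn d V} {ζ : ℂ} (hζ : ζ ∈ spectrum ℂ (extend T)) :
    Paravector.ofComplex u ζ ∈ sSpectrum T := by
  intro h
  have h' := h.map extend
  rw [extend_quadOp_ofComplex hu, (commute_algebraMap_sub (extend T) ζ (conj ζ)).isUnit_mul_iff]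
    at h'
  exact hζ h'.1

/-- A complex spectral point `ζ` yields a point of the `S`-spectrum on the slice of `s` itself,
where the Euclidean distance is `|z - ζ|`. -/
theorem le_norm_sub_of_le_setDist {u : Fin d → ℝ} (hu : ∑ j, u j ^ 2 = 1)
    {T : Vn d V →L[ℝ] Vn d V} {C : Set (Paravector d)} {δ : ℝ}
    (hδ : ENNReal.ofReal δ ≤ setDist C (sSpectrum T)) {z : ℂ} (hz : Paravector.ofComplex u z ∈ C) :
    ∀ ζ ∈ spectrum ℂ (extend T), δ ≤ ‖z - ζ‖ := by
  intro ζ hζ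
  have h := hδ.trans ((iInf₂_le _ hz).trans (iInf₂_le _ (ofComplex_mem_sSpectrum hu hζ)))
  rw [edist_dist, Paravector.dist_ofComplex hu] at h
  exact (ENNReal.ofReal_le_ofReal_iff (norm_nonneg _)).1 h

theorem norm_add_mul_le {A : Type*} [SeminormedRing A] {a b j : A} {M L : ℝ} (ha : ‖a‖ ≤ M)
    (hb : ‖b‖ ≤ M) (hj : ‖j‖ ≤ L) : ‖a + b * j‖ ≤ M * (1 + L) ∧ ‖a + j * b‖ ≤ M * (1 + L) := by
  have hM := (norm_nonneg a).trans ha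
  have h : ‖b‖ * ‖j‖ ≤ M * L := by gcongr
  constructor
  · linarith [norm_add_le a (b * j), norm_mul_le b j]
  · linarith [norm_add_le a (j * b), norm_mul_le j b]

theorem norm_resolventStar_le [CompleteSpace V] {u : Fin d → ℝ} (hu : ∑ j, u j ^ 2 = 1)
    {T : Vn d V →L[ℝ] Vn d V} {z : ℂ} (hz : z ∈ resolventSet ℂ (extend T))
    (hz' : conj z ∈ resolventSet ℂ (extend T)) (m n : ℕ) {M : ℝ}
    (hM : ‖resolvent (extend T) z ^ m * resolvent (extend T) (conj z) ^ n‖ ≤ M) :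
    ‖leftResolventStar T (Paravector.ofComplex u z) m n‖ ≤ M * (1 + ∑ j, ‖unitMul (n := d) V j‖) ∧
    ‖rightResolventStar T (Paravector.ofComplex u z) m n‖ ≤ M * (1 + ∑ j, ‖unitMul (n := d) V j‖) := by
  obtain ⟨U, hU⟩ := hz
  obtain ⟨W, hW⟩ := hz'
  have hUW : Commute U W := by
    rw [← Commute.units_val_iff, hU, hW]
    exact commute_algebraMap_sub _ _ _
  set s := Paravector.ofComplex u z with hs
  -- Hence `Ring.inverse` is a true inverse here, not the default `0`.
  obtain ⟨q, hq⟩ : IsUnit (quadOp s T) := isUnit_of_isUnit_extend <| by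
    rw [hs, extend_quadOp_ofComplex hu, ← hU, ← hW]
    exact (U * W).isUnit
  have hqi : Ring.inverse (quadOp s T) = (↑q⁻¹ : Vn d V →L[ℝ] Vn d V) := by
    rw [← hq, Ring.inverse_unit]
  have hext : extend (↑q⁻¹ : Vn d V →L[ℝ] Vn d V) = ↑(U * W)⁻¹ := by
    have : Units.map (extend : (Vn d V →L[ℝ] Vn d V) →+* _).toMonoidHom q = U * W := by
      ext1
      simp [hq, hs, extend_quadOp_ofComplex hu, hU, hW]
    rw [← this, ← map_inv]
    rfl
  set P : Polynomial ℂ := (Polynomial.C (conj z) - Polynomial.X) ^ m *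
    (Polynomial.C z - Polynomial.X) ^ n with hP
  have hpoly : linearFactor s.conj ^ m * linearFactor s ^ n =
      P.map (sliceHom hu : ℂ →+* RClifford d) := by
    rw [hs, Paravector.conj_ofComplex, linearFactor_ofComplex hu, linearFactor_ofComplex hu, hP,
      Polynomial.map_mul, Polynomial.map_pow, Polynomial.map_pow]
  have hae : Polynomial.aeval (extend T) P = ↑(W ^ m * U ^ n) := by
    simp [hP, hU, hW]
  have hR : resolvent (extend T) z ^ m * resolvent (extend T) (conj z) ^ n =
      ↑(U⁻¹ ^ m * W⁻¹ ^ n) := by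
    rw [resolvent, resolvent, ← hU, ← hW, Ring.inverse_unit, Ring.inverse_unit]
    simp
  rw [hR] at hM
  rw [aeval_extend] at hae
  have hl : extend ((↑q⁻¹ : Vn d V →L[ℝ] Vn d V) ^ (m + n) * reEval T P) +
      Complex.I • extend ((↑q⁻¹ : Vn d V →L[ℝ] Vn d V) ^ (m + n) * imEval T P) =
      ↑(U⁻¹ ^ m * W⁻¹ ^ n) := by
    rw [map_mul, map_mul, ← mul_smul_comm, ← mul_add, hae, map_pow, hext, ← Units.val_pow_eq_pow_val,
      ← Units.val_mul, hUW.mul_inv_pow_mul]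
  have hr : extend (reEval T P * (↑q⁻¹ : Vn d V →L[ℝ] Vn d V) ^ (m + n)) +
      Complex.I • extend (imEval T P * (↑q⁻¹ : Vn d V →L[ℝ] Vn d V) ^ (m + n)) =
      ↑(U⁻¹ ^ m * W⁻¹ ^ n) := by
    rw [map_mul, map_mul, ← smul_mul_assoc, ← add_mul, hae, map_pow, hext,
      ← Units.val_pow_eq_pow_val, ← Units.val_mul, ← hUW.mul_inv_pow_mul]
    -- The polynomial in `T` commutes with the inverse of `Q_s(T)`, so the right version has the
    -- same complex form.
    congr 1
    have h1 : Commute (U * W) U := (Commute.refl U).mul_left hUW.symm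
    have h2 : Commute (U * W) W := hUW.mul_left (Commute.refl W)
    exact (((h2.pow_right m).mul_right (h1.pow_right n)).inv_left.pow_left _).symm
  rw [leftResolventStar, rightResolventStar, hpoly, evalCoeffRight_map, evalCoeffLeft_map, hqi,
    mul_add, add_mul, mul_assoc, ← mul_assoc _ (imEval T P)]
  exact ⟨(norm_add_mul_le ((norm_le_norm_extend_add_left _ _).trans (hl ▸ hM))
      ((norm_le_norm_extend_add_right _ _).trans (hl ▸ hM)) (norm_leftMul_ι_le hu)).1,
    (norm_add_mul_le ((norm_le_norm_extend_add_left _ _).trans (hr ▸ hM))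
      ((norm_le_norm_extend_add_right _ _).trans (hr ▸ hM)) (norm_leftMul_ι_le hu)).2⟩

end SFunctionalCalculus

end

theorem proposition6p2 (d : ℕ) (hd : 1 ≤ d)
    (V : Type*) [NormedAddCommGroup V] [NormedSpace ℝ V] [CompleteSpace V]
    (T : SFunctionalCalculus.Vn d V →L[ℝ] SFunctionalCalculus.Vn d V)
    (hT : T ∈ SFunctionalCalculus.paravectorOperators d V)
    (C : Set (SFunctionalCalculus.Paravector d)) (ε : ℝ) (hε : 0 < ε)
    (hC : ENNReal.ofReal ε <
      SFunctionalCalculus.setDist C (SFunctionalCalculus.sSpectrum T)) :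
    ∃ K : ℝ, 0 < K ∧ ∀ s ∈ C, ∀ m n : ℕ,
      ‖SFunctionalCalculus.leftResolventStar T s m n‖ ≤ K / ε ^ (m + n) ∧
      ‖SFunctionalCalculus.rightResolventStar T s m n‖ ≤ K / ε ^ (m + n) := by
  -- A real `δ` leaves room above `ε` and also covers infinite distance.
  obtain ⟨δ, -, hεδ, hδC⟩ := ENNReal.lt_iff_exists_real_btwn.1 hC
  have hεδ : ε < δ := lt_of_not_ge fun h => hεδ.not_ge (ENNReal.ofReal_le_ofReal h)
  obtain ⟨K, hK, h⟩ := exists_bound_resolvent_pow (Complexification.extend T) hε hεδ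
  set L : ℝ := 1 + ∑ j, ‖SFunctionalCalculus.unitMul (n := d) V j‖
  -- One factor `K` for each of `z` and `z̄`, and `L` for the unit `u`; the `+ 1` ensures
  -- positivity, as `K` may be `0`.
  refine ⟨K * K * L + 1, by positivity, fun s hs m n => ?_⟩
  obtain ⟨u, z, hu, rfl⟩ := SFunctionalCalculus.Paravector.exists_eq_ofComplex hd s
  have hz := SFunctionalCalculus.le_norm_sub_of_le_setDist hu hδC.le hs
  have hz' := SFunctionalCalculus.le_norm_sub_of_le_setDist (u := -u) (z := conj z)
    (by simpa using hu) hδC.le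
    (by rwa [SFunctionalCalculus.Paravector.ofComplex_neg_conj])
  have hδ := hε.trans hεδ
  have hbound : K / ε ^ m * (K / ε ^ n) * L ≤ (K * K * L + 1) / ε ^ (m + n) := by
    rw [div_mul_div_comm, ← pow_add, div_mul_eq_mul_div]
    gcongr
    linarith
  have := SFunctionalCalculus.norm_resolventStar_le hu (mem_resolventSet_of_le_norm_sub hδ hz)
    (mem_resolventSet_of_le_norm_sub hδ hz') m n ((norm_mul_le _ _).trans
      (mul_le_mul (h z hz m) (h _ hz' n) (norm_nonneg _) (by positivity)))
  exact ⟨this.1.trans hbound, this.2.trans hbound⟩
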